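/- Let $n\ge 1$ and let $\mathcal H(n,\mathbb C)$ be the group, under composition, of all maps $z\mapsto \lambda z+b$ of $\mathbb C^n$ with $\lambda\in\mathbb C^*$ and $b\in\mathbb C^n$; $\lambda$ is called the ratio of the map, and the maps of ratio $1$ are the translations. Let $\mathcal{SR}_n=\mathcal S_2\mathcal R_n\cup\mathcal S_3\mathcal R_n$, where $\mathcal S_i\mathcal R_n$ is the set of all maps $z\mapsto e^{i\theta}z+b$ with $b\in\mathbb C^n$ and $\theta\in H_i$, and $$H_2=\left(\tfrac{\pi}{2}+\pi\mathbb Z\right)\cup\pi\mathbb Z,\qquad H_3=\left(\tfrac{\pi}{3}+\pi\mathbb Z\right)\cup\left(-\tfrac{\pi}{3}+\pi\mathbb Z\right)\cup\pi\mathbb Z .$$ For a subgroup $G$ of $\mathcal H(n,\mathbb C)$ let $\Lambda_G\subset\mathbb C^*$ be the set of ratios of the elements of $G$, let $G_1$ be the subgroup of translations in $G$, and let $\Gamma_G$ be the set of all fixed points of elements of $G\setminus G_1$. Let $E_G$ be the complex affine subspace of $\mathbb C^n$ generated by $\Gamma_G\cup\bigcup_{a\in\Gamma_G}G_1(a)$,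 where $G_1(a)=\{f(a): f\in G_1\}$, and put $U=\mathbb C^n\setminus E_G$. The orbit of $z\in\mathbb C^n$ is $G(z)=\{f(z): f\in G\}$. Let $G$ be a non-abelian subgroup of $\mathcal H(n,\mathbb C)$ such that $\Lambda_G\setminus\mathbb R\neq\emptyset$ and $G\setminus\mathcal{SR}_n\neq\emptyset$. Then the following assertions are equivalent: (1) $G$ has a dense orbit in $\mathbb C^n$; (2) for every $z\in U$ the orbit $G(z)$ is dense in $\mathbb C^n$ (this holds vacuously if $U=\emptyset$); (3) either $E_G=\mathbb C^n$, or $\dim_{\mathbb C} E_G=n-1$ and $\overline{\Lambda_G}=\mathbb C$. -/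

import Mathlib

namespace AffHomothety

/-- The self-map `f` of `ℂⁿ` has the form `z ↦ r • z + b`. If `r ≠ 1` it is the affine homothety
with ratio `r` and center `(1 - r)⁻¹ • b`; if `r = 1` it is the translation by `b`. -/
def HasForm {n : ℕ} (f : Equiv.Perm (Fin n → ℂ)) (r : ℂ) (b : Fin n → ℂ) : Prop :=
  ∀ z, f z = r • z + b

/-- The group `ℋ(n, ℂ)` of all maps `z ↦ r • z + b` with `r ∈ ℂ^*` and `b ∈ ℂⁿ`, under
composition. -/
def homotheties (n : ℕ) : Subgroup (Equiv.Perm (Fin n → ℂ)) where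
  carrier := {f | ∃ r : ℂ, r ≠ 0 ∧ ∃ b, HasForm f r b}
  one_mem' := ⟨1, one_ne_zero, 0, fun z => by simp⟩
  mul_mem' := by
    rintro f g ⟨r, hr, b, hf⟩ ⟨s, hs, c, hg⟩
    refine ⟨r * s, mul_ne_zero hr hs, r • c + b, fun z => ?_⟩
    rw [Equiv.Perm.mul_apply, hg z, hf]
    module
  inv_mem' := by
    rintro f ⟨r, hr, b, hf⟩
    refine ⟨r⁻¹, inv_ne_zero hr, -(r⁻¹ • b), fun z => ?_⟩
    rw [Equiv.Perm.inv_eq_iff_eq, hf, smul_add, smul_neg, smul_inv_smul₀ hr, smul_inv_smul₀ hr]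
    abel

/-- The translations of `ℂⁿ`, a subset of `ℋ(n, ℂ)`. -/
def translations (n : ℕ) : Set (Equiv.Perm (Fin n → ℂ)) :=
  {f | ∃ b, HasForm f 1 b}

/-- `H₂ = (π/2 + πℤ) ∪ πℤ`. -/
def angles₂ : Set ℝ :=
  {θ | (∃ k : ℤ, θ = Real.pi / 2 + k * Real.pi) ∨ (∃ k : ℤ, θ = k * Real.pi)}

/-- `H₃ = (π/3 + πℤ) ∪ (-π/3 + πℤ) ∪ πℤ`. -/
def angles₃ : Set ℝ :=
  {θ | (∃ k : ℤ, θ = Real.pi / 3 + k * Real.pi) ∨ (∃ k : ℤ, θ = -(Real.pi / 3) + k * Real.pi) ∨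
    (∃ k : ℤ, θ = k * Real.pi)}

/-- The maps `z ↦ e^{iθ} z + b` of `ℂⁿ` with `θ ∈ H` and `b ∈ ℂⁿ`. -/
def rotationsWithAngleIn (n : ℕ) (H : Set ℝ) : Set (Equiv.Perm (Fin n → ℂ)) :=
  {f | ∃ θ ∈ H, ∃ b, HasForm f (Complex.exp (θ * Complex.I)) b}

/-- `𝒮ℛₙ = 𝒮₂ℛₙ ∪ 𝒮₃ℛₙ`. -/
def specialRotations (n : ℕ) : Set (Equiv.Perm (Fin n → ℂ)) :=
  rotationsWithAngleIn n angles₂ ∪ rotationsWithAngleIn n angles₃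

/-- `Λ_G`, the set of the ratios of the elements of `G`; a translation has ratio `1`. -/
def ratios {n : ℕ} (G : Subgroup (Equiv.Perm (Fin n → ℂ))) : Set ℂ :=
  {r | r ≠ 0 ∧ ∃ f ∈ G, ∃ b, HasForm f r b}

/-- `Γ_G`, the set of the fixed points (centers) of the elements of `G` that are not
translations. -/
def centers {n : ℕ} (G : Subgroup (Equiv.Perm (Fin n → ℂ))) : Set (Fin n → ℂ) :=
  {a | ∃ f ∈ G, f ∉ translations n ∧ f a = a}

/-- `G₁(a)`, the orbit of `a` under the translations `G₁` in `G`. -/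
def translationOrbit {n : ℕ} (G : Subgroup (Equiv.Perm (Fin n → ℂ))) (a : Fin n → ℂ) :
    Set (Fin n → ℂ) :=
  {x | ∃ f ∈ G, f ∈ translations n ∧ f a = x}

/-- `E_G`, the complex affine subspace of `ℂⁿ` generated by `Γ_G` and the sets `G₁(a)`,
`a ∈ Γ_G`. The base point of `G₁(·)` has to be a center: the span of `Γ_G ∪ G₁(0)` always contains
the origin, so it is not invariant under `G` in general and does not follow `G` under conjugation
by translations. The two agree when the origin is a center (`hull_eq_of_zero_mem`). -/
def hull {n : ℕ} (G : Subgroup (Equiv.Perm (Fin n → ℂ))) : AffineSubspace ℂ (Fin n → ℂ) :=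
  affineSpan ℂ (centers G ∪ ⋃ a ∈ centers G, translationOrbit G a)

/-- `Γ_G` contains `G₁(a)` for every `a ∈ Γ_G`. -/
theorem translationOrbit_subset_centers {n : ℕ} (G : Subgroup (Equiv.Perm (Fin n → ℂ)))
    {a : Fin n → ℂ} (ha : a ∈ centers G) : translationOrbit G a ⊆ centers G := by
  obtain ⟨f, hf, hft, hfa⟩ := ha
  rintro x ⟨t, ht, ⟨b, hb⟩, rfl⟩
  refine ⟨t * f * t⁻¹, G.mul_mem (G.mul_mem ht hf) (G.inv_mem ht), ?_, by simp [hfa]⟩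
  rintro ⟨c, hc⟩
  refine hft ⟨c, fun z => ?_⟩
  have h := hc (t z)
  have ht' : t⁻¹ (t z) = z := t.symm_apply_apply z
  rw [Equiv.Perm.mul_apply, Equiv.Perm.mul_apply, ht'] at h
  rw [hb, hb, one_smul, one_smul, one_smul] at h
  rw [one_smul]
  have h' : f z + b = (z + c) + b := by rw [h]; abel
  exact add_right_cancel h'

/-- If the origin is a center, then `E_G` is the affine subspace generated by `Γ_G ∪ G₁(0)`. -/
theorem hull_eq_of_zero_mem {n : ℕ} (G : Subgroup (Equiv.Perm (Fin n → ℂ)))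
    (h : (0 : Fin n → ℂ) ∈ centers G) :
    hull G = affineSpan ℂ (centers G ∪ translationOrbit G 0) := by
  have h₁ : (⋃ a ∈ centers G, translationOrbit G a) ⊆ centers G :=
    Set.iUnion₂_subset fun _ ha => translationOrbit_subset_centers G ha
  rw [hull, Set.union_eq_left.2 h₁, Set.union_eq_left.2 (translationOrbit_subset_centers G h)]

end AffHomothety

namespace AffHomothety

/-! Conjugation in `G` multiplies translation vectors by ratios, so the ratios lie in the subring
`multipliers G`. This subring has a nonreal element, hence is dense unless its nonzero elements all
have norm at least 1; in that case every ratio has an angle in `H₂ ∪ H₃`, which `hSR` excludes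
(`dense_multipliers`).

So the closure of the translation vectors is a complex subspace. Commutators put nonzero multiples
of differences of centers into it, so it contains the direction `V` of `E_G`, and orbit closures are
invariant under `V`. With a center `a` as origin, an element of ratio `r` acts modulo `V` as
multiplication by `r`. The orbit of `z` is thus dense exactly when `V` is everything, or `z - a`
spans a line complementary to `V` and the ratios are dense in `ℂ`. -/

/-! ### Dense subrings of `ℂ` -/

/-- A subring of `ℂ` with a nonreal element and arbitrarily small nonzero elements is dense. -/
theorem dense_subring_of_small {S : Subring ℂ} {ν : ℂ} (hν : ν ∈ S) (him : ν.im ≠ 0)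
    (hsmall : ∀ ε > 0, ∃ s ∈ S, s ≠ 0 ∧ ‖s‖ < ε) : Dense (S : Set ℂ) := by
  intro z
  rw [Metric.mem_closure_iff]
  intro ε hε
  have hpos : 0 < 1 + ‖ν‖ := by positivity
  obtain ⟨s, hs, hs0, hsε⟩ := hsmall (ε / (1 + ‖ν‖)) (by positivity)
  -- Real coordinates of `z / s` in the basis `1, ν`; rounding them gives a point of the lattice
  -- `s(ℤ + ℤν)` near `z`.
  set y : ℝ := (z / s).im / ν.im
  set x : ℝ := (z / s).re - y * ν.re
  have hz : z / s = x + y * ν := by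
    apply Complex.ext
    · simp [x]
    · simp [y, div_mul_cancel₀ _ him]
  refine ⟨s * ((round x : ℤ) + (round y : ℤ) * ν),
    S.mul_mem hs (S.add_mem (intCast_mem S _) (S.mul_mem (intCast_mem S _) hν)), ?_⟩
  have hz' : z = s * (x + y * ν) := by rw [← hz, mul_div_cancel₀ _ hs0]
  have hdiff : z - s * ((round x : ℤ) + (round y : ℤ) * ν)
      = s * (((x - round x : ℝ) : ℂ) + ((y - round y : ℝ) : ℂ) * ν) := by
    rw [hz']; push_cast; ring
  have hx : |x - round x| ≤ 1 := (abs_sub_round x).trans (by norm_num)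
  have hy : |y - round y| ≤ 1 := (abs_sub_round y).trans (by norm_num)
  have hle : ‖((x - round x : ℝ) : ℂ) + ((y - round y : ℝ) : ℂ) * ν‖ ≤ 1 + ‖ν‖ := by
    refine (norm_add_le _ _).trans ?_
    rw [norm_mul, Complex.norm_real, Complex.norm_real, Real.norm_eq_abs, Real.norm_eq_abs]
    have := mul_le_mul_of_nonneg_right hy (norm_nonneg ν)
    linarith
  rw [dist_eq_norm, hdiff, norm_mul]
  calc ‖s‖ * _ ≤ ‖s‖ * (1 + ‖ν‖) := mul_le_mul_of_nonneg_left hle (norm_nonneg s)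
    _ < ε := (lt_div_iff₀ hpos).1 hsε

/-- If the nonzero elements of a subring of `ℂ` have norm at least `1`, then the trace of each of
its units is an integer `k` with `|k| ≤ 2`. -/
theorem exists_int_trace_of_unit {S : Subring ℂ} (hS : ∀ s ∈ S, s ≠ 0 → 1 ≤ ‖s‖) {r : ℂ}
    (hr0 : r ≠ 0) (hr : r ∈ S) (hr' : r⁻¹ ∈ S) : ∃ k : ℤ, |k| ≤ 2 ∧ r + r⁻¹ = k := by
  have hnorm : ‖r‖ = 1 := by
    refine le_antisymm ?_ (hS r hr hr0)
    have h := hS _ hr' (inv_ne_zero hr0)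
    rw [norm_inv] at h
    exact (one_le_inv₀ (norm_pos_iff.2 hr0)).1 h
  have hinv : r + r⁻¹ = ((2 * r.re : ℝ) : ℂ) := by
    rw [Complex.inv_eq_conj hnorm, Complex.add_conj]
  -- The fractional part of the trace lies in `S` and has norm less than 1.
  have hfract : Int.fract (2 * r.re) = 0 := by
    by_contra h
    have hmem : ((Int.fract (2 * r.re) : ℝ) : ℂ) ∈ S := by
      rw [Int.fract, Complex.ofReal_sub, ← hinv, Complex.ofReal_intCast]
      exact S.sub_mem (S.add_mem hr hr') (intCast_mem S _)
    have h1 := hS _ hmem (by exact_mod_cast h)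
    rw [Complex.norm_real, Real.norm_eq_abs, abs_of_nonneg (Int.fract_nonneg _)] at h1
    exact absurd (Int.fract_lt_one (2 * r.re)) (not_lt.2 h1)
  have hfloor : 2 * r.re = (⌊2 * r.re⌋ : ℤ) := by
    have := Int.floor_add_fract (2 * r.re)
    rw [hfract, add_zero] at this
    exact this.symm
  refine ⟨⌊2 * r.re⌋, ?_, ?_⟩
  · have h : |2 * r.re| ≤ 2 := by
      have := Complex.abs_re_le_norm r
      rw [abs_mul, abs_two]
      linarith
    rw [hfloor] at h
    exact_mod_cast h
  · rw [hinv, hfloor, Int.floor_intCast, Complex.ofReal_intCast]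

/-- The roots of `X² - 2 cos θ X + 1` are `e^{±iθ}`. -/
theorem eq_exp_or_eq_exp_neg {r : ℂ} (hr : r ≠ 0) {θ : ℝ}
    (h : r + r⁻¹ = ((2 * Real.cos θ : ℝ) : ℂ)) :
    r = Complex.exp (θ * Complex.I) ∨ r = Complex.exp ((-θ : ℝ) * Complex.I) := by
  have hmul : Complex.exp (θ * Complex.I) * Complex.exp ((-θ : ℝ) * Complex.I) = 1 := by
    rw [← Complex.exp_add]; simp
  have hadd : ((2 * Real.cos θ : ℝ) : ℂ)
      = Complex.exp (θ * Complex.I) + Complex.exp ((-θ : ℝ) * Complex.I) := by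
    push_cast
    rw [Complex.two_cos]
  rw [hadd] at h
  have hfac : (r - Complex.exp (θ * Complex.I)) * (r - Complex.exp ((-θ : ℝ) * Complex.I)) = 0 := by
    have h2 := congrArg (· * r) h
    simp only [add_mul, inv_mul_cancel₀ hr] at h2
    linear_combination h2 + hmul
  rcases mul_eq_zero.1 hfac with h | h
  · exact Or.inl (sub_eq_zero.1 h)
  · exact Or.inr (sub_eq_zero.1 h)

theorem exists_angle_of_int_trace {r : ℂ} (hr : r ≠ 0) {k : ℤ} (hk : |k| ≤ 2) (h : r + r⁻¹ = k) :
    ∃ θ ∈ angles₂ ∪ angles₃, r = Complex.exp ((θ : ℝ) * Complex.I) := by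
  have key : ∀ θ : ℝ, 2 * Real.cos θ = k → θ ∈ angles₂ ∪ angles₃ → -θ ∈ angles₂ ∪ angles₃ →
      ∃ θ ∈ angles₂ ∪ angles₃, r = Complex.exp ((θ : ℝ) * Complex.I) := by
    intro θ hθ hm hm'
    rcases eq_exp_or_eq_exp_neg (θ := θ) hr (by rw [h, hθ, Complex.ofReal_intCast]) with h | h
    · exact ⟨θ, hm, h⟩
    · exact ⟨-θ, hm', h⟩
  obtain ⟨hk1, hk2⟩ := abs_le.1 hk
  interval_cases k
  · exact key Real.pi (by simp) (.inl (.inr ⟨1, by simp⟩)) (.inl (.inr ⟨-1, by simp⟩))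
  · refine key (Real.pi - Real.pi / 3) ?_ (.inr (.inr (.inl ⟨1, by push_cast; ring⟩)))
      (.inr (.inl ⟨-1, by push_cast; ring⟩))
    rw [Real.cos_pi_sub, Real.cos_pi_div_three]; norm_num
  · exact key (Real.pi / 2) (by simp) (.inl (.inl ⟨0, by simp⟩))
      (.inl (.inl ⟨-1, by push_cast; ring⟩))
  · exact key (Real.pi / 3) (by simp) (.inr (.inl ⟨0, by simp⟩)) (.inr (.inr (.inl ⟨0, by simp⟩)))
  · exact key 0 (by simp) (.inl (.inr ⟨0, by simp⟩)) (.inl (.inr ⟨0, by simp⟩))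

/-- A subring of `ℂ` with a nonreal element is dense, unless its units are fourth or sixth roots
of unity. -/
theorem dense_subring_of_unit {S : Subring ℂ} {ν r : ℂ} (hν : ν ∈ S) (him : ν.im ≠ 0)
    (hr0 : r ≠ 0) (hr : r ∈ S) (hr' : r⁻¹ ∈ S)
    (hangle : ∀ θ ∈ angles₂ ∪ angles₃, r ≠ Complex.exp ((θ : ℝ) * Complex.I)) :
    Dense (S : Set ℂ) := by
  by_cases hS : ∀ s ∈ S, s ≠ 0 → 1 ≤ ‖s‖
  · obtain ⟨k, hk, h⟩ := exists_int_trace_of_unit hS hr0 hr hr'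
    obtain ⟨θ, hθ, h⟩ := exists_angle_of_int_trace hr0 hk h
    exact absurd h (hangle θ hθ)
  · push Not at hS
    obtain ⟨s, hs, hs0, hs1⟩ := hS
    refine dense_subring_of_small hν him fun ε hε => ?_
    obtain ⟨m, hm⟩ := exists_pow_lt_of_lt_one hε hs1
    exact ⟨s ^ m, S.pow_mem hs m, pow_ne_zero m hs0, by rwa [norm_pow]⟩

/-! ### Translation vectors and their multipliers -/

variable {n : ℕ} {G : Subgroup (Equiv.Perm (Fin n → ℂ))}

theorem HasForm.apply_eq {f : Equiv.Perm (Fin n → ℂ)} {r : ℂ} {b : Fin n → ℂ} (h : HasForm f r b)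
    (z a : Fin n → ℂ) : f z = f a + r • (z - a) := by
  rw [h z, h a]; module

theorem HasForm.inv {f : Equiv.Perm (Fin n → ℂ)} {r : ℂ} {b : Fin n → ℂ} (hr : r ≠ 0)
    (h : HasForm f r b) : HasForm f⁻¹ r⁻¹ (-(r⁻¹ • b)) := fun z => by
  rw [Equiv.Perm.inv_eq_iff_eq, h, smul_add, smul_neg, smul_inv_smul₀ hr, smul_inv_smul₀ hr]
  abel

/-- The vectors of the translations in `G`. -/
def translationVectors (G : Subgroup (Equiv.Perm (Fin n → ℂ))) : AddSubgroup (Fin n → ℂ) where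
  carrier := {t | ∃ f ∈ G, HasForm f 1 t}
  zero_mem' := ⟨1, G.one_mem, fun z => by simp⟩
  add_mem' := by
    rintro s t ⟨f, hf, hfs⟩ ⟨g, hg, hgt⟩
    refine ⟨f * g, G.mul_mem hf hg, fun z => ?_⟩
    rw [Equiv.Perm.mul_apply, hgt, hfs]
    module
  neg_mem' := by
    rintro t ⟨f, hf, hft⟩
    refine ⟨f⁻¹, G.inv_mem hf, ?_⟩
    simpa using hft.inv one_ne_zero

/-- The scalars that preserve the vectors of the translations in `G`. -/
def multipliers (G : Subgroup (Equiv.Perm (Fin n → ℂ))) : Subring ℂ where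
  carrier := {c | ∀ t ∈ translationVectors G, c • t ∈ translationVectors G}
  mul_mem' {c d} hc hd t ht := by rw [mul_smul]; exact hc _ (hd _ ht)
  one_mem' t ht := by rwa [one_smul]
  add_mem' {c d} hc hd t ht := by rw [add_smul]; exact add_mem (hc _ ht) (hd _ ht)
  zero_mem' t ht := by rw [zero_smul]; exact zero_mem _
  neg_mem' {c} hc t ht := by rw [neg_smul]; exact neg_mem (hc _ ht)

theorem ratios_subset_multipliers : ratios G ⊆ multipliers G := by
  rintro r ⟨hr, f, hf, b, hfb⟩ t ⟨g, hg, hgt⟩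
  refine ⟨f * g * f⁻¹, G.mul_mem (G.mul_mem hf hg) (G.inv_mem hf), fun z => ?_⟩
  rw [Equiv.Perm.mul_apply, Equiv.Perm.mul_apply, hfb.inv hr, hgt, hfb]
  simp only [one_smul, smul_add, smul_neg, smul_inv_smul₀ hr]
  abel

theorem inv_mem_ratios {r : ℂ} (hr : r ∈ ratios G) : r⁻¹ ∈ ratios G := by
  obtain ⟨hr, f, hf, b, hfb⟩ := hr
  exact ⟨inv_ne_zero hr, f⁻¹, G.inv_mem hf, _, hfb.inv hr⟩

theorem dense_multipliers (hG : G ≤ homotheties n)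
    (hnonreal : (ratios G \ Set.range ((↑) : ℝ → ℂ)).Nonempty)
    (hSR : ¬ ((G : Set (Equiv.Perm (Fin n → ℂ))) ⊆ specialRotations n)) :
    Dense (multipliers G : Set ℂ) := by
  obtain ⟨ν, hν, hνr⟩ := hnonreal
  obtain ⟨f, hf, hfS⟩ := Set.not_subset.1 hSR
  obtain ⟨r, hr0, b, hfb⟩ := hG hf
  have hr : r ∈ ratios G := ⟨hr0, f, hf, b, hfb⟩
  refine dense_subring_of_unit (ratios_subset_multipliers hν) (fun h => hνr ⟨ν.re, ?_⟩) hr0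
    (ratios_subset_multipliers hr) (ratios_subset_multipliers (inv_mem_ratios hr)) ?_
  · exact Complex.ext (by simp) (by simp [h])
  · rintro θ (hθ | hθ) rfl
    · exact hfS (.inl ⟨θ, hθ, b, hfb⟩)
    · exact hfS (.inr ⟨θ, hθ, b, hfb⟩)

/-- The commutator of two elements of `G` with centers `a` and `c` translates by a nonzero multiple
of `a - c`. -/
theorem exists_smul_sub_mem_translationVectors (hG : G ≤ homotheties n) {a c : Fin n → ℂ}
    (ha : a ∈ centers G) (hc : c ∈ centers G) :
    ∃ m : ℂ, m ≠ 0 ∧ m • (a - c) ∈ translationVectors G := by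
  obtain ⟨f, hf, hft, hfa⟩ := ha
  obtain ⟨g, hg, hgt, hgc⟩ := hc
  obtain ⟨r, hr, b, hfb⟩ := hG hf
  obtain ⟨s, hs, d, hgd⟩ := hG hg
  have hr1 : r ≠ 1 := by rintro rfl; exact hft ⟨b, hfb⟩
  have hs1 : s ≠ 1 := by rintro rfl; exact hgt ⟨d, hgd⟩
  refine ⟨(1 - r) * (1 - s), mul_ne_zero (sub_ne_zero.2 hr1.symm) (sub_ne_zero.2 hs1.symm),
    f * g * f⁻¹ * g⁻¹,
    G.mul_mem (G.mul_mem (G.mul_mem hf hg) (G.inv_mem hf)) (G.inv_mem hg), fun z => ?_⟩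
  -- At `z = g (f w)` the commutator takes the value `f (g w)`, so no inverse has to be computed.
  obtain ⟨w, rfl⟩ : ∃ w, z = g (f w) :=
    ⟨f⁻¹ (g⁻¹ z), by simp⟩
  have h : (f * g * f⁻¹ * g⁻¹) (g (f w)) = f (g w) := by simp
  rw [h, hfb.apply_eq (g w) a, hfa, hgd.apply_eq w c, hgd.apply_eq (f w) c, hgc,
    hfb.apply_eq w a, hfa]
  module

/-- The closure of the translation vectors, when it is a complex subspace. -/
noncomputable def translationClosure (G : Subgroup (Equiv.Perm (Fin n → ℂ)))
    (hd : Dense (multipliers G : Set ℂ)) : Submodule ℂ (Fin n → ℂ) where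
  toAddSubmonoid := (translationVectors G).topologicalClosure.toAddSubmonoid
  smul_mem' c _ hx := map_mem_closure₂ continuous_smul (hd c) hx fun _ hs t ht => hs t ht

/-! ### The direction of `E_G` -/

theorem direction_hull_subset_closure (hG : G ≤ homotheties n)
    (hd : Dense (multipliers G : Set ℂ)) :
    ((hull G).direction : Set (Fin n → ℂ)) ⊆ closure (translationVectors G) := by
  have h₁ : (⋃ a ∈ centers G, translationOrbit G a) ⊆ centers G :=
    Set.iUnion₂_subset fun _ ha => translationOrbit_subset_centers G ha
  change (hull G).direction ≤ translationClosure G hd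
  rw [hull, Set.union_eq_left.2 h₁, direction_affineSpan, vectorSpan, Submodule.span_le]
  rintro _ ⟨a, ha, c, hc, rfl⟩
  obtain ⟨m, hm, hmem⟩ := exists_smul_sub_mem_translationVectors hG ha hc
  have hmem' : m • (a - c) ∈ translationClosure G hd := subset_closure hmem
  exact (Submodule.smul_mem_iff _ hm).1 hmem'

theorem centers_subset_hull : centers G ⊆ hull G := fun _ ha =>
  subset_affineSpan ℂ _ (Or.inl ha)

/-- A translation keeps `a` in `E_G` by definition; any other element scales about its own center,
which also lies in `E_G`. -/
theorem apply_sub_mem_direction (hG : G ≤ homotheties n) {a : Fin n → ℂ} (ha : a ∈ centers G)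
    {f : Equiv.Perm (Fin n → ℂ)} (hf : f ∈ G) : f a - a ∈ (hull G).direction := by
  by_cases hft : f ∈ translations n
  · exact AffineSubspace.vsub_mem_direction
      (subset_affineSpan ℂ _ (Or.inr (Set.mem_biUnion ha ⟨f, hf, hft, rfl⟩)))
      (centers_subset_hull ha)
  · obtain ⟨r, hr, b, hfb⟩ := hG hf
    have hr1 : 1 - r ≠ 0 := sub_ne_zero.2 (by rintro rfl; exact hft ⟨b, hfb⟩)
    have hfix : f ((1 - r)⁻¹ • b) = (1 - r)⁻¹ • b := by
      rw [hfb]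
      nth_rewrite 2 [← inv_smul_smul₀ hr1 b]
      module
    have hc : (1 - r)⁻¹ • b ∈ hull G := centers_subset_hull ⟨f, hf, hft, hfix⟩
    have h : f a - a = (1 - r) • ((1 - r)⁻¹ • b - a) := by
      rw [hfb.apply_eq a ((1 - r)⁻¹ • b), hfix]
      module
    rw [h]
    exact Submodule.smul_mem _ _ (AffineSubspace.vsub_mem_direction hc (centers_subset_hull ha))

theorem centers_nonempty [NeZero n] (h : ∃ r ∈ ratios G, r ≠ 1) : (centers G).Nonempty := by
  obtain ⟨r, ⟨-, f, hf, b, hfb⟩, hr⟩ := h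
  have hr1 : 1 - r ≠ 0 := sub_ne_zero.2 hr.symm
  refine ⟨(1 - r)⁻¹ • b, f, hf, ?_, ?_⟩
  · rintro ⟨c, hc⟩
    -- Comparing two values recovers the ratio from the map; this needs a nonzero vector, hence `n ≠
    -- 0`.
    have h0 := hfb.apply_eq 1 0
    rw [hc.apply_eq 1 0] at h0
    have h1 := congrFun (add_left_cancel h0) 0
    simp only [Pi.smul_apply, sub_zero, Pi.one_apply, smul_eq_mul, mul_one] at h1
    exact hr h1.symm
  · rw [hfb]
    nth_rewrite 2 [← inv_smul_smul₀ hr1 b]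
    module

/-! ### Orbit closures -/

theorem apply_mem_orbit {f : Equiv.Perm (Fin n → ℂ)} (hf : f ∈ G) (z : Fin n → ℂ) :
    f z ∈ MulAction.orbit G z := ⟨⟨f, hf⟩, rfl⟩

/-- The closure of every orbit is invariant under the direction of `E_G`, provided that the
multipliers are dense. -/
theorem add_mem_closure_orbit (hG : G ≤ homotheties n) (hd : Dense (multipliers G : Set ℂ))
    {f : Equiv.Perm (Fin n → ℂ)} (hf : f ∈ G) (z : Fin n → ℂ) {v : Fin n → ℂ}
    (hv : v ∈ (hull G).direction) : f z + v ∈ closure (MulAction.orbit G z) := by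
  refine map_mem_closure (continuous_const.add continuous_id)
    (direction_hull_subset_closure hG hd hv) ?_
  rintro t ⟨g, hg, hgt⟩
  have h : f z + t = (g * f) z := by rw [Equiv.Perm.mul_apply, hgt, one_smul]
  exact h ▸ apply_mem_orbit (G.mul_mem hg hf) z

theorem dense_orbit_of_hull_eq_top (hG : G ≤ homotheties n) (hd : Dense (multipliers G : Set ℂ))
    (h : hull G = ⊤) (z : Fin n → ℂ) : Dense (MulAction.orbit G z) := fun w => by
  have := add_mem_closure_orbit hG hd G.one_mem z (v := w - z) (by simp [h])
  simpa using this

theorem sup_span_eq_top {V : Submodule ℂ (Fin n → ℂ)} (hV : Module.finrank ℂ V + 1 = n)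
    {u : Fin n → ℂ} (hu : u ∉ V) : V ⊔ Submodule.span ℂ {u} = ⊤ := by
  have hlt : V < V ⊔ Submodule.span ℂ {u} :=
    lt_of_le_of_ne le_sup_left fun h =>
      hu (h ▸ Submodule.mem_sup_right (Submodule.mem_span_singleton_self u))
  have h1 := Submodule.finrank_lt_finrank_of_lt hlt
  have h2 := Submodule.finrank_le (V ⊔ Submodule.span ℂ {u})
  refine Submodule.eq_top_of_finrank_eq ?_
  rw [Module.finrank_fin_fun] at h2 ⊢
  omega

theorem dense_orbit_of_notMem_hull (hG : G ≤ homotheties n) (hd : Dense (multipliers G : Set ℂ))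
    {a : Fin n → ℂ} (ha : a ∈ centers G)
    (hdim : Module.finrank ℂ (hull G).direction + 1 = n)
    (hr : closure (ratios G) = Set.univ) {z : Fin n → ℂ} (hz : z ∉ hull G) :
    Dense (MulAction.orbit G z) := fun w => by
  have hu : z - a ∉ (hull G).direction := fun h =>
    hz ((AffineSubspace.vsub_right_mem_direction_iff_mem (centers_subset_hull ha) z).1 h)
  have hw : w - a ∈ (hull G).direction ⊔ Submodule.span ℂ {z - a} := by
    rw [sup_span_eq_top hdim hu]; trivial
  obtain ⟨v, hv, u, hu', hvu⟩ := Submodule.mem_sup.1 hw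
  obtain ⟨c, rfl⟩ := Submodule.mem_span_singleton.1 hu'
  have hc : c ∈ closure (ratios G) := hr ▸ Set.mem_univ c
  have hcont : Continuous fun c : ℂ => a + v + c • (z - a) := by fun_prop
  have hmem := map_mem_closure hcont hc (t := closure (MulAction.orbit G z)) ?_
  · rw [closure_closure] at hmem
    have h : a + v + c • (z - a) = w := by
      rw [add_assoc, hvu]; abel
    exact h ▸ hmem
  · rintro r ⟨-, f, hf, b, hfb⟩
    -- The displacement `f a - a` lies in the direction, so it can be absorbed into `v`.
    have := add_mem_closure_orbit hG hd hf z
      (Submodule.sub_mem _ hv (apply_sub_mem_direction hG ha hf))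
    have h : a + v + r • (z - a) = f z + (v - (f a - a)) := by
      rw [hfb.apply_eq z a]; abel
    simpa only [h] using this

theorem hull_of_dense_orbit (hG : G ≤ homotheties n) {a : Fin n → ℂ} (ha : a ∈ centers G)
    {z : Fin n → ℂ} (hz : Dense (MulAction.orbit G z)) :
    hull G = ⊤ ∨ (Module.finrank ℂ (hull G).direction + 1 = n ∧
      closure (ratios G) = Set.univ) := by
  rw [or_iff_not_imp_left]
  intro hne
  have hVne : (hull G).direction ≠ ⊤ := fun h => hne
    ((AffineSubspace.direction_eq_top_iff_of_nonempty ⟨a, centers_subset_hull ha⟩).1 h)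
  have horb : ∀ w ∈ MulAction.orbit G z, ∃ r ∈ ratios G, ∃ v ∈ (hull G).direction,
      w - a = v + r • (z - a) := by
    rintro _ ⟨⟨f, hf⟩, rfl⟩
    obtain ⟨r, hr, b, hfb⟩ := hG hf
    refine ⟨r, ⟨hr, f, hf, b, hfb⟩, f a - a, apply_sub_mem_direction hG ha hf, ?_⟩
    change f z - a = _
    rw [hfb.apply_eq z a]; abel
  have htop : (hull G).direction ⊔ Submodule.span ℂ {z - a} = ⊤ := by
    refine Submodule.eq_top_iff'.2 fun u => ?_
    have hcl : IsClosed (((hull G).direction ⊔ Submodule.span ℂ {z - a} :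
        Submodule ℂ (Fin n → ℂ)) : Set (Fin n → ℂ)) := Submodule.closed_of_finiteDimensional _
    have hcont : Continuous fun w : Fin n → ℂ => w - a := by fun_prop
    have := map_mem_closure hcont (hz (u + a)) (t := ((hull G).direction ⊔
      Submodule.span ℂ {z - a} : Submodule ℂ (Fin n → ℂ))) fun w hw => ?_
    · rwa [hcl.closure_eq, add_sub_cancel_right] at this
    · obtain ⟨r, -, v, hv, h⟩ := horb w hw
      rw [h]
      exact Submodule.add_mem_sup hv (Submodule.smul_mem _ _ (Submodule.mem_span_singleton_self _))
  have hu : z - a ∉ (hull G).direction := fun h => hVne <| by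
    rwa [sup_eq_left.2 ((Submodule.span_singleton_le_iff_mem _ _).2 h)] at htop
  constructor
  · have h1 := Submodule.finrank_lt (lt_top_iff_ne_top.2 hVne).ne
    have h2 := Submodule.finrank_add_le_finrank_add_finrank (hull G).direction
      (Submodule.span ℂ {z - a})
    have h3 := finrank_span_singleton (K := ℂ)
      (v := z - a) fun h => hu (h ▸ Submodule.zero_mem _)
    rw [htop, finrank_top, h3, Module.finrank_fin_fun] at h2
    rw [Module.finrank_fin_fun] at h1
    omega
  · obtain ⟨φ, hφ, hker⟩ := Submodule.exists_le_ker_of_notMem hu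
    have hcont : Continuous fun w : Fin n → ℂ => φ (w - a) / φ (z - a) :=
      (φ.continuous_of_finiteDimensional.comp (by fun_prop)).div_const _
    refine Set.eq_univ_of_forall fun c => ?_
    have := map_mem_closure hcont (hz (a + c • (z - a))) (t := ratios G) fun w hw => ?_
    · simpa [hφ, -map_sub] using this
    · obtain ⟨r, hr, v, hv, h⟩ := horb w hw
      have hv0 : φ v = 0 := hker hv
      simpa [h, hv0, hφ, -map_sub] using hr

end AffHomothety

theorem corollary1p4 (n : ℕ) (G : Subgroup (Equiv.Perm (Fin n → ℂ)))
    (hG : G ≤ AffHomothety.homotheties n)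
    (hnonab : ∃ f ∈ G, ∃ g ∈ G, f * g ≠ g * f)
    (hnonreal : (AffHomothety.ratios G \ Set.range ((↑) : ℝ → ℂ)).Nonempty)
    (hSR : ¬ ((G : Set (Equiv.Perm (Fin n → ℂ))) ⊆ AffHomothety.specialRotations n)) :
    [∃ z : Fin n → ℂ, Dense (MulAction.orbit G z),
     ∀ z : Fin n → ℂ, z ∉ AffHomothety.hull G → Dense (MulAction.orbit G z),
     AffHomothety.hull G = ⊤ ∨
       (Module.finrank ℂ (AffHomothety.hull G).direction + 1 = n ∧
         closure (AffHomothety.ratios G) = Set.univ)].TFAE := by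
  have hn : NeZero n := ⟨by
    rintro rfl
    obtain ⟨f, -, g, -, h⟩ := hnonab
    exact h (Subsingleton.elim _ _)⟩
  have hd := AffHomothety.dense_multipliers hG hnonreal hSR
  obtain ⟨a, ha⟩ : (AffHomothety.centers G).Nonempty := by
    obtain ⟨r, hr, hreal⟩ := hnonreal
    exact AffHomothety.centers_nonempty ⟨r, hr, fun h => hreal ⟨1, by simp [h]⟩⟩
  tfae_have 1 → 3 := fun ⟨_, hz⟩ => AffHomothety.hull_of_dense_orbit hG ha hz
  tfae_have 3 → 2 := by
    rintro (h | ⟨hdim, hr⟩) z hz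
    · exact AffHomothety.dense_orbit_of_hull_eq_top hG hd h z
    · exact AffHomothety.dense_orbit_of_notMem_hull hG hd ha hdim hr hz
  tfae_have 2 → 1 := by
    intro h
    by_cases htop : AffHomothety.hull G = ⊤
    · exact ⟨0, AffHomothety.dense_orbit_of_hull_eq_top hG hd htop 0⟩
    -- Without a dense orbit no point could lie outside `E_G`.
    · by_contra! hno
      exact htop (eq_top_iff.2 fun z _ => by_contra fun hz => hno z (h z hz))
  tfae_finish
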